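/- Let $a,m\ge 2$, let $n\ge a+m-1$ and put $r=n-a-m+2$. Represent a partition of $[n]=\{1,\dots,n\}$ with blocks $B_1,\dots,B_k$, listed so that $\min B_1<\cdots<\min B_k$, by the word $\pi=\pi_1\cdots\pi_n$ with $i\in B_{\pi_i}$ for every $i\in[n]$ (its canonical sequential form). Let $NC_n$ be the set of non-crossing partitions of $[n]$, i.e. those for which there are no indices $i<j<k<l$ with $\pi_i=\pi_k<\pi_j=\pi_l$. An occurrence in $\pi$ of the subword $\tau=12\cdots(m-1)m^a$ (the letters $1,\dots,m-1$ followed by $a$ copies of $m$) is a string of $|\tau|=a+m-1$ consecutive letters of $\pi$ that is order-isomorphic to $\tau$. Then the total number of occurrences of $\tau$ in all the members of $NC_n$ is $$\frac{r}{2r+m}\binom{2r+m}{r}.$$ -/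

import Mathlib

namespace NCSubword

/-- The canonical sequential form of a partition of an `n`-element linearly ordered set
(`Fin n` stands for `[n]`, shifted by one).  If the blocks `B₁, B₂, …` are listed by increasing
minimum, then the `i`-th letter is the index `k` with `i ∈ B_k`; that is, the number of blocks
whose minimum is at most the minimum of the block of `i`.  Letters start from `1`. -/
def letter {n : ℕ} (P : Finpartition (Finset.univ : Finset (Fin n))) (i : Fin n) : ℕ :=
  (P.parts.filter (fun B => B.min ≤ (P.part i).min)).card

/-- The canonical sequential form `π₁ ⋯ πₙ` as a word. -/
def canonicalForm {n : ℕ} (P : Finpartition (Finset.univ : Finset (Fin n))) : List ℕ :=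
  List.ofFn (letter P)

/-- A partition is non-crossing if its canonical sequential form has no subsequence
`a-b-a-b` with `a < b`. -/
def IsNonCrossing {n : ℕ} (P : Finpartition (Finset.univ : Finset (Fin n))) : Prop :=
  ¬ ∃ i j k l : Fin n, i < j ∧ j < k ∧ k < l ∧
    letter P i = letter P k ∧ letter P j = letter P l ∧ letter P i < letter P j

instance {n : ℕ} (P : Finpartition (Finset.univ : Finset (Fin n))) :
    Decidable (IsNonCrossing P) := by
  unfold IsNonCrossing; infer_instance

/-- The set `NC_n` of non-crossing partitions of an `n`-element linearly ordered set. -/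
def NC (n : ℕ) : Finset (Finpartition (Finset.univ : Finset (Fin n))) :=
  Finset.univ.filter IsNonCrossing

/-- Two words are order-isomorphic: they have the same length, and their letters compare in the
same way at every pair of positions (`<` in both directions also determines `=`). -/
def OrderIsomorphic (u v : List ℕ) : Prop :=
  u.length = v.length ∧
    ∀ i < u.length, ∀ j < u.length, (u.getD i 0 < u.getD j 0 ↔ v.getD i 0 < v.getD j 0)

instance (u v : List ℕ) : Decidable (OrderIsomorphic u v) := by
  unfold OrderIsomorphic; infer_instance

/-- `μ_τ(w)`: the number of occurrences of `τ` in `w` as a subword, that is, the number of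
starting positions `i` such that the `|τ|` consecutive letters of `w` from `i` on exist and are
order-isomorphic to `τ`. -/
def occurrences (τ w : List ℕ) : ℕ :=
  ((Finset.range (w.length + 1)).filter (fun i =>
    i + τ.length ≤ w.length ∧ OrderIsomorphic ((w.drop i).take τ.length) τ)).card

/-- The pattern `12⋯(m-1)m^a`. -/
def pattern (a m : ℕ) : List ℕ :=
  List.range' 1 (m - 1) ++ List.replicate a m

end NCSubword

namespace NCSubword

/-! Non-crossing words are grown one letter at a time. The next letter is either a new maximum or a
letter never yet followed by a smaller one (`IsNCWord.update_iff`). If `h` letters are reusable,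
appending the `h + 1` admissible letters produces each of the heights `1, …, h + 1` once
(`sum_extensions_height`).

Reusable letters never exceed the last letter, so an ascent must be a new maximum and raises the
height by one, while a plateau keeps the height. An occurrence of the pattern therefore contributes
one forced continuation that raises the height by `m - 1`; the plateau only uses up length
(`card_words_ascends_plateau`).

What remains depends on heights alone. Summing over starting positions gives the recursion
`ascentCount`, solved by ballot numbers (`extensionCount_add_choose`, `ascentCount_succ`). Its value
at height one is `(2r+m-1).choose (r-1)`, which equals the stated expression. -/

/-! ### Growing non-crossing words letter by letter -/

/-- Words of length `n`, extended by zero, that are canonical sequential forms of non-crossing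
partitions. -/
structure IsNCWord (n : ℕ) (w : ℕ → ℕ) : Prop where
  pos : ∀ i < n, 1 ≤ w i
  attains : ∀ i < n, ∀ v, 1 ≤ v → v < w i → ∃ j < i, w j = v
  nonCrossing : ∀ i j k l, i < j → j < k → k < l → l < n → w i = w k → w j = w l → ¬ w i < w j
  support : ∀ i, n ≤ i → w i = 0

/-- The letters of a word of length `n` that are never followed by a smaller letter. -/
def stack (n : ℕ) (w : ℕ → ℕ) : Finset ℕ :=
  ((Finset.range n).image w).filter (fun x => ∀ i < n, ∀ j < n, i < j → w i = x → x ≤ w j)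

/-- The largest letter of a word of length `n`. -/
def maxLetter (n : ℕ) (w : ℕ → ℕ) : ℕ := (Finset.range n).sup w

/-- The letters that may be appended to a non-crossing word of length `n`. -/
def extensions (n : ℕ) (w : ℕ → ℕ) : Finset ℕ := insert (maxLetter n w + 1) (stack n w)

lemma mem_stack {n : ℕ} {w : ℕ → ℕ} {x : ℕ} :
    x ∈ stack n w ↔ (∃ i < n, w i = x) ∧ ∀ i < n, ∀ j < n, i < j → w i = x → x ≤ w j := by
  simp [stack]

lemma le_maxLetter {n : ℕ} {w : ℕ → ℕ} {i : ℕ} (hi : i < n) : w i ≤ maxLetter n w :=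
  Finset.le_sup (f := w) (Finset.mem_range.2 hi)

lemma le_maxLetter_of_mem_stack {n : ℕ} {w : ℕ → ℕ} {x : ℕ} (hx : x ∈ stack n w) :
    x ≤ maxLetter n w := by
  obtain ⟨⟨i, hi, rfl⟩, -⟩ := mem_stack.1 hx
  exact le_maxLetter hi

lemma IsNCWord.exists_eq {n : ℕ} {w : ℕ → ℕ} (h : IsNCWord n w) {x : ℕ} (hx : 1 ≤ x)
    (hxm : x ≤ maxLetter n w) : ∃ i < n, w i = x := by
  have : (Finset.range n).Nonempty := by
    by_contra hne
    rw [Finset.not_nonempty_iff_eq_empty] at hne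
    simp [maxLetter, hne] at hxm
    omega
  obtain ⟨i, hi, him⟩ := Finset.exists_mem_eq_sup _ this w
  rw [Finset.mem_range] at hi
  rcases (hxm.trans_eq him).eq_or_lt with h1 | h1
  · exact ⟨i, hi, h1.symm⟩
  · obtain ⟨j, hj, hjx⟩ := h.attains i hi x hx h1
    exact ⟨j, hj.trans hi, hjx⟩

lemma IsNCWord.restrict {n : ℕ} {w : ℕ → ℕ} (h : IsNCWord (n + 1) w) :
    IsNCWord n (Function.update w n 0) := by
  have key : ∀ i < n, Function.update w n 0 i = w i := fun i hi =>
    Function.update_of_ne hi.ne _ _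
  refine ⟨fun i hi => ?_, fun i hi v hv hvi => ?_, fun i j k l hij hjk hkl hl => ?_,
    fun i hi => ?_⟩
  · rw [key i hi]; exact h.pos i (by omega)
  · rw [key i hi] at hvi
    obtain ⟨j, hj, hjv⟩ := h.attains i (by omega) v hv hvi
    exact ⟨j, hj, by rw [key j (by omega), hjv]⟩
  · rw [key i (by omega), key j (by omega), key k (by omega), key l (by omega)]
    exact h.nonCrossing i j k l hij hjk hkl (by omega)
  · by_cases hin : i = n
    · simp [hin]
    · rw [Function.update_of_ne hin]; exact h.support i (by omega)

lemma IsNCWord.update_iff {n : ℕ} {w : ℕ → ℕ} (h : IsNCWord n w) (x : ℕ) :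
    IsNCWord (n + 1) (Function.update w n x) ↔ x ∈ extensions n w := by
  have key : ∀ i < n, Function.update w n x i = w i := fun i hi =>
    Function.update_of_ne hi.ne _ _
  have keyn : Function.update w n x n = x := Function.update_self ..
  constructor
  · intro h'
    have hx1 : 1 ≤ x := by simpa [keyn] using h'.pos n (by omega)
    rw [extensions, Finset.mem_insert]
    by_cases hxm : maxLetter n w < x
    · left
      by_contra hne
      obtain ⟨j, hj, hjx⟩ := h'.attains n (by omega) (maxLetter n w + 1) (by omega)
        (by rw [keyn]; omega)
      rw [key j hj] at hjx
      have := le_maxLetter (w := w) hj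
      omega
    · right
      refine mem_stack.2 ⟨h.exists_eq hx1 (by omega), fun i hi j hj hij hix => ?_⟩
      by_contra hlt
      -- The smaller letter `w j` already occurs before position `i`, so positions `p < i < j < n`
      -- would form a crossing.
      obtain ⟨p, hp, hpj⟩ := h.attains i hi (w j) (h.pos j hj) (by omega)
      refine h'.nonCrossing p i j n hp hij hj (by omega) ?_ ?_ ?_
      · rw [key p (by omega), key j hj, hpj]
      · rw [key i hi, keyn, hix]
      · rw [key p (by omega), key i hi]; omega
  · intro hx
    have hx' : x = maxLetter n w + 1 ∨ x ∈ stack n w := by simpa [extensions] using hx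
    refine ⟨fun i hi => ?_, fun i hi v hv hvi => ?_, fun i j k l hij hjk hkl hl => ?_,
      fun i hi => ?_⟩
    · rcases Nat.lt_succ_iff_lt_or_eq.1 hi with hi | rfl
      · rw [key i hi]; exact h.pos i hi
      · rw [keyn]
        rcases hx' with rfl | hx'
        · omega
        · obtain ⟨⟨j, hj, rfl⟩, -⟩ := mem_stack.1 hx'
          exact h.pos j hj
    · rcases Nat.lt_succ_iff_lt_or_eq.1 hi with hi | rfl
      · rw [key i hi] at hvi
        obtain ⟨j, hj, hjv⟩ := h.attains i hi v hv hvi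
        exact ⟨j, hj, by rw [key j (by omega), hjv]⟩
      · rw [keyn] at hvi
        have : v ≤ maxLetter i w := by
          rcases hx' with rfl | hx'
          · omega
          · have := le_maxLetter_of_mem_stack hx'
            omega
        obtain ⟨j, hj, hjv⟩ := h.exists_eq hv this
        exact ⟨j, hj, by rw [key j hj, hjv]⟩
    · rcases Nat.lt_succ_iff_lt_or_eq.1 hl with hl | rfl
      · rw [key i (by omega), key j (by omega), key k (by omega), key l (by omega)]
        exact h.nonCrossing i j k l hij hjk hkl (by omega)
      · rw [key i (by omega), key j (by omega), key k (by omega), keyn]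
        intro hik hjx hlt
        rcases hx' with rfl | hx'
        · have := le_maxLetter (w := w) (show j < l by omega)
          omega
        · have := (mem_stack.1 hx').2 j (by omega) k (by omega) hjk hjx
          omega
    · rw [Function.update_of_ne (by omega)]; exact h.support i (by omega)

/-- Appending `x` closes every letter above `x` and leaves those below open. -/
lemma stack_update {n : ℕ} {w : ℕ → ℕ} {x : ℕ} (hx : x ∈ extensions n w) :
    stack (n + 1) (Function.update w n x) = insert x ((stack n w).filter (· < x)) := by
  have key : ∀ i < n, Function.update w n x i = w i := fun i hi =>
    Function.update_of_ne hi.ne _ _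
  have keyn : Function.update w n x n = x := Function.update_self ..
  have hx' : x = maxLetter n w + 1 ∨ x ∈ stack n w := by simpa [extensions] using hx
  ext y
  rw [mem_stack, Finset.mem_insert, Finset.mem_filter, mem_stack]
  constructor
  · rintro ⟨⟨i, hi, hiy⟩, hy⟩
    by_cases hyx : y = x
    · exact Or.inl hyx
    right
    have hin : i < n := by
      rcases Nat.lt_succ_iff_lt_or_eq.1 hi with hi | rfl
      · exact hi
      · rw [keyn] at hiy; exact absurd hiy.symm hyx
    have h1 := hy i hi n (by omega) hin hiy
    rw [keyn] at h1
    refine ⟨⟨⟨i, hin, by rw [← key i hin, hiy]⟩, fun p hp q hq hpq hpy => ?_⟩, by omega⟩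
    have := hy p (by omega) q (by omega) hpq (by rw [key p hp, hpy])
    rwa [key q hq] at this
  · rintro (rfl | ⟨⟨⟨i, hi, hiy⟩, hy⟩, hyx⟩)
    · refine ⟨⟨n, by omega, keyn⟩, fun i hi j hj hij hiy => ?_⟩
      rcases Nat.lt_succ_iff_lt_or_eq.1 hj with hj | rfl
      · rw [key i (by omega)] at hiy
        rw [key j hj]
        rcases hx' with h1 | h1
        · have := le_maxLetter (w := w) (show i < n by omega)
          omega
        · exact (mem_stack.1 h1).2 i (by omega) j hj hij hiy
      · rw [keyn]
    · refine ⟨⟨i, by omega, by rw [key i hi, hiy]⟩, fun p hp q hq hpq hpy => ?_⟩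
      rw [key p (by omega)] at hpy
      rcases Nat.lt_succ_iff_lt_or_eq.1 hq with hq | rfl
      · rw [key q hq]
        exact hy p (by omega) q hq hpq hpy
      · rw [keyn]; omega

/-! ### Heights and the generating tree -/

/-- The number of letters of a word that may be used again. -/
def height (n : ℕ) (w : ℕ → ℕ) : ℕ := (stack n w).card

lemma height_update {n : ℕ} {w : ℕ → ℕ} {x : ℕ} (hx : x ∈ extensions n w) :
    height (n + 1) (Function.update w n x) = ((extensions n w).filter (· < x)).card + 1 := by
  have hfil : (extensions n w).filter (· < x) = (stack n w).filter (· < x) := by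
    rw [extensions, Finset.filter_insert, if_neg]
    rw [extensions, Finset.mem_insert] at hx
    rcases hx with rfl | hx
    · omega
    · have := le_maxLetter_of_mem_stack hx
      omega
  rw [height, stack_update hx, hfil, Finset.card_insert_of_notMem (by simp)]

lemma card_extensions (n : ℕ) (w : ℕ → ℕ) : (extensions n w).card = height n w + 1 := by
  rw [extensions, Finset.card_insert_of_notMem, height]
  intro h
  have := le_maxLetter_of_mem_stack h
  omega

/-- The rank of an element within `S` runs bijectively over `0, …, |S| - 1`. -/
lemma sum_card_filter_lt {M : Type*} [AddCommMonoid M] (S : Finset ℕ) (F : ℕ → M) :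
    ∑ x ∈ S, F ((S.filter (· < x)).card) = ∑ j ∈ Finset.range S.card, F j := by
  induction S using Finset.induction_on_max with
  | empty => simp
  | insert b S hb ih =>
    have hbS : b ∉ S := fun h => (hb b h).false
    rw [Finset.sum_insert hbS, Finset.card_insert_of_notMem hbS, Finset.sum_range_succ, ← ih,
      add_comm]
    congr 1
    · refine Finset.sum_congr rfl fun x hx => ?_
      rw [Finset.filter_insert, if_neg (hb x hx).not_gt]
    · rw [Finset.filter_insert, if_neg (lt_irrefl b), Finset.filter_true_of_mem hb]

lemma sum_extensions_height {M : Type*} [AddCommMonoid M] (n : ℕ) (w : ℕ → ℕ) (F : ℕ → M) :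
    ∑ x ∈ extensions n w, F (height (n + 1) (Function.update w n x)) =
      ∑ j ∈ Finset.range (height n w + 1), F (j + 1) := by
  rw [← card_extensions, ← sum_card_filter_lt _ fun j => F (j + 1)]
  exact Finset.sum_congr rfl fun x hx => by rw [height_update hx]

open Classical in
/-- The set of non-crossing words of length `n`. -/
noncomputable def words : ℕ → Finset (ℕ → ℕ)
  | 0 => {fun _ => 0}
  | n + 1 => (words n).biUnion fun w => (extensions n w).image (Function.update w n)

lemma mem_words {n : ℕ} {w : ℕ → ℕ} : w ∈ words n ↔ IsNCWord n w := by
  induction n generalizing w with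
  | zero =>
    rw [words, Finset.mem_singleton]
    constructor
    · rintro rfl
      exact ⟨by simp, by simp, by simp, by simp⟩
    · intro h
      funext i
      exact h.support i (Nat.zero_le i)
  | succ n ih =>
    simp only [words, Finset.mem_biUnion, Finset.mem_image]
    constructor
    · rintro ⟨u, hu, x, hx, rfl⟩
      exact ((ih.1 hu).update_iff x).2 hx
    · intro h
      refine ⟨Function.update w n 0, ih.2 h.restrict, w n, ?_, by simp⟩
      rw [← h.restrict.update_iff]
      simpa using h

open Classical in
lemma sum_words_succ {M : Type*} [AddCommMonoid M] (n : ℕ) (F : (ℕ → ℕ) → M) :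
    ∑ w ∈ words (n + 1), F w =
      ∑ w ∈ words n, ∑ x ∈ extensions n w, F (Function.update w n x) := by
  rw [words, Finset.sum_biUnion]
  · refine Finset.sum_congr rfl fun w _ => ?_
    rw [Finset.sum_image]
    intro x _ y _ hxy
    simpa using congrFun hxy n
  · intro u hu v hv huv
    rw [Function.onFun, Finset.disjoint_left]
    intro t ht ht'
    obtain ⟨x, -, rfl⟩ := Finset.mem_image.1 ht
    obtain ⟨y, -, hy⟩ := Finset.mem_image.1 ht'
    apply huv
    funext i
    by_cases hi : i = n
    -- Extension by zero makes the two prefixes agree at the overwritten position.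
    · rw [hi, (mem_words.1 hu).support n le_rfl, (mem_words.1 hv).support n le_rfl]
    · have := congrFun hy i
      rw [Function.update_of_ne hi, Function.update_of_ne hi] at this
      exact this.symm

/-! ### Ascents, plateaus and free continuations -/

lemma last_mem_stack {n : ℕ} {w : ℕ → ℕ} (h : IsNCWord (n + 1) w) : w n ∈ stack (n + 1) w := by
  have hw : Function.update (Function.update w n 0) n (w n) = w := by simp
  have hx : w n ∈ extensions n (Function.update w n 0) := by
    rw [← h.restrict.update_iff, hw]; exact h
  have := stack_update hx
  rw [hw] at this
  rw [this]
  exact Finset.mem_insert_self _ _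

lemma le_last_of_mem_stack {n : ℕ} {w : ℕ → ℕ} {x : ℕ} (hx : x ∈ stack (n + 1) w) : x ≤ w n := by
  obtain ⟨⟨i, hi, hix⟩, h⟩ := mem_stack.1 hx
  rcases Nat.lt_succ_iff_lt_or_eq.1 hi with hi' | rfl
  · exact h i hi n (by omega) hi' hix
  · exact hix.ge

/-- Only the new maximum exceeds the last letter, and it leaves the whole stack open. -/
lemma sum_extensions_ascent {M : Type*} [AddCommMonoid M] {n : ℕ} {w : ℕ → ℕ}
    (F : ℕ → M) :
    (∑ x ∈ extensions (n + 1) w,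
      if w n < x then F (height (n + 2) (Function.update w (n + 1) x)) else 0) =
      F (height (n + 1) w + 1) := by
  have hmem : maxLetter (n + 1) w + 1 ∈ extensions (n + 1) w := Finset.mem_insert_self _ _
  rw [Finset.sum_eq_single_of_mem _ hmem]
  · rw [if_pos (Nat.lt_succ_of_le (le_maxLetter (Nat.lt_succ_self n))), height_update hmem]
    congr 2
    rw [height, extensions, Finset.filter_insert, if_neg (lt_irrefl _), Finset.filter_true_of_mem]
    exact fun x hx => Nat.lt_succ_of_le (le_maxLetter_of_mem_stack hx)
  · intro x hx hne
    rw [if_neg]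
    have := le_last_of_mem_stack (Finset.mem_of_mem_insert_of_ne hx hne)
    omega

/-- The last letter is the top of the stack, so repeating it closes nothing. -/
lemma sum_extensions_plateau {M : Type*} [AddCommMonoid M] {n : ℕ} {w : ℕ → ℕ}
    (F : ℕ → M) (h : IsNCWord (n + 1) w) :
    (∑ x ∈ extensions (n + 1) w,
      if w n = x then F (height (n + 2) (Function.update w (n + 1) x)) else 0) =
      F (height (n + 1) w) := by
  have hmem : w n ∈ extensions (n + 1) w := Finset.mem_insert_of_mem (last_mem_stack h)
  rw [Finset.sum_ite_eq, if_pos hmem]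
  congr 1
  rw [height, stack_update hmem, height]
  congr 1
  ext y
  rw [Finset.mem_insert, Finset.mem_filter]
  constructor
  · rintro (rfl | hy)
    · exact last_mem_stack h
    · exact hy.1
  · intro hy
    rcases (le_last_of_mem_stack hy).eq_or_lt with h1 | h1
    · exact Or.inl h1
    · exact Or.inr ⟨hy, h1⟩

/-- The number of ways to append `t` letters to a non-crossing word of height `h`. -/
def extensionCount : ℕ → ℕ → ℕ
  | 0, _ => 1
  | t + 1, h => ∑ j ∈ Finset.range (h + 1), extensionCount t (j + 1)

/-- The word `w` has `c` consecutive ascents starting at position `i`. -/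
def Ascends (i c : ℕ) (w : ℕ → ℕ) : Prop := ∀ p < c, w (i + p) < w (i + p + 1)

/-- The word `w` is constant for `d` steps starting at position `i`. -/
def Plateau (i d : ℕ) (w : ℕ → ℕ) : Prop := ∀ p < d, w (i + p) = w (i + p + 1)

lemma ascends_update {i c n x : ℕ} {w : ℕ → ℕ} (h : i + c < n) :
    Ascends i c (Function.update w n x) ↔ Ascends i c w := by
  refine forall₂_congr fun p hp => ?_
  rw [Function.update_of_ne (by omega), Function.update_of_ne (by omega)]

lemma plateau_update {i c n x : ℕ} {w : ℕ → ℕ} (h : i + c < n) :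
    Plateau i c (Function.update w n x) ↔ Plateau i c w := by
  refine forall₂_congr fun p hp => ?_
  rw [Function.update_of_ne (by omega), Function.update_of_ne (by omega)]

lemma ascends_succ {i c : ℕ} {w : ℕ → ℕ} :
    Ascends i (c + 1) w ↔ Ascends i c w ∧ w (i + c) < w (i + c + 1) := by
  exact Nat.forall_lt_succ_right

lemma plateau_succ {i c : ℕ} {w : ℕ → ℕ} :
    Plateau i (c + 1) w ↔ Plateau i c w ∧ w (i + c) = w (i + c + 1) := by
  exact Nat.forall_lt_succ_right

open Classical in
lemma sum_words_ascends {M : Type*} [AddCommMonoid M] (i c : ℕ) (F : ℕ → M) :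
    (∑ w ∈ words (i + c + 1), if Ascends i c w then F (height (i + c + 1) w) else 0) =
      ∑ u ∈ words (i + 1), F (height (i + 1) u + c) := by
  induction c generalizing F with
  | zero => simp [Ascends]
  | succ c ih =>
    rw [show i + (c + 1) + 1 = i + c + 1 + 1 by omega, sum_words_succ]
    have hF : ∀ h, F (h + (c + 1)) = F (h + c + 1) := fun h => by rw [add_assoc]
    simp only [hF]
    rw [← ih fun h => F (h + 1)]
    refine Finset.sum_congr rfl fun u _ => ?_
    simp only [ascends_succ, ascends_update (show i + c < i + c + 1 by omega)]
    by_cases hA : Ascends i c u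
    · simp only [hA, true_and, if_true, ← sum_extensions_ascent (w := u) F]
      refine Finset.sum_congr rfl fun x _ => ?_
      rw [Function.update_self, Function.update_of_ne (by omega)]
    · simp [hA]

open Classical in
lemma sum_words_ascends_plateau {M : Type*} [AddCommMonoid M] (i c d : ℕ) (F : ℕ → M) :
    (∑ w ∈ words (i + c + d + 1), if Ascends i c w ∧ Plateau (i + c) d w then
      F (height (i + c + d + 1) w) else 0) =
      ∑ u ∈ words (i + 1), F (height (i + 1) u + c) := by
  induction d generalizing F with
  | zero => simpa [Plateau] using sum_words_ascends i c F
  | succ d ih =>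
    rw [show i + c + (d + 1) + 1 = i + c + d + 1 + 1 by omega, sum_words_succ, ← ih]
    refine Finset.sum_congr rfl fun u hu => ?_
    simp only [plateau_succ, plateau_update (show i + c + d < i + c + d + 1 by omega),
      ascends_update (show i + c < i + c + d + 1 by omega), ← and_assoc]
    by_cases hA : Ascends i c u ∧ Plateau (i + c) d u
    · simp only [hA, true_and, if_true, ← sum_extensions_plateau F (mem_words.1 hu)]
      refine Finset.sum_congr rfl fun x _ => ?_
      rw [Function.update_self, Function.update_of_ne (by omega)]
    · simp [hA]

open Classical in
lemma card_words_ascends_plateau (i c d t : ℕ) :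
    ((words (i + c + d + 1 + t)).filter fun w => Ascends i c w ∧ Plateau (i + c) d w).card =
      ∑ u ∈ words (i + 1), extensionCount t (height (i + 1) u + c) := by
  rw [← sum_words_ascends_plateau i c d, Finset.card_filter]
  -- The parameter `s` lets the induction trade each actual trailing letter for one letter counted
  -- by `extensionCount`.
  suffices ∀ s, (∑ w ∈ words (i + c + d + 1 + t), if Ascends i c w ∧ Plateau (i + c) d w then
      extensionCount s (height (i + c + d + 1 + t) w) else 0) =
      ∑ w ∈ words (i + c + d + 1), if Ascends i c w ∧ Plateau (i + c) d w then
      extensionCount (s + t) (height (i + c + d + 1) w) else 0 by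
    simpa only [extensionCount, zero_add] using this 0
  induction t with
  | zero => simp
  | succ t ih =>
    intro s
    rw [← add_assoc (i + c + d + 1), sum_words_succ, show s + (t + 1) = s + 1 + t by omega,
      ← ih (s + 1)]
    refine Finset.sum_congr rfl fun u hu => ?_
    simp only [plateau_update (show i + c + d < i + c + d + 1 + t by omega),
      ascends_update (show i + c < i + c + d + 1 + t by omega)]
    split_ifs
    · exact sum_extensions_height _ u _
    · simp

/-! ### Summation over starting positions -/

/-- The number of runs of `c` ascents, counted over all ways to append letters to a word of height
`j`, where a run starting `k` letters after the end of that word may be followed by `R - k` more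
letters. -/
def ascentCount (c : ℕ) : ℕ → ℕ → ℕ
  | 0, _ => 1
  | R + 1, j => extensionCount (R + 1) (j + c) +
      ∑ k ∈ Finset.range (j + 1), ascentCount c R (k + 1)

/-- The first summand of the recursion is the run starting at once, `i = 0`; its other summands are
the children, that is, words one letter longer. -/
lemma sum_words_ascentCount (c R k : ℕ) :
    ∑ u ∈ words k, ascentCount c R (height k u) =
      ∑ i ∈ Finset.range (R + 1),
        ∑ u ∈ words (k + i), extensionCount (R - i) (height (k + i) u + c) := by
  induction R generalizing k with
  | zero => simp [ascentCount, extensionCount]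
  | succ R ih =>
    rw [Finset.sum_range_succ']
    simp only [ascentCount, Finset.sum_add_distrib]
    rw [add_comm]
    congr 1
    simp only [← sum_extensions_height, ← sum_words_succ _ fun w => ascentCount c R (height (k + 1) w)]
    rw [ih]
    refine Finset.sum_congr rfl fun i _ => ?_
    rw [show k + 1 + i = k + (i + 1) by omega, show R + 1 - (i + 1) = R - i by omega]

lemma sum_words_one {M : Type*} [AddCommMonoid M] (F : ℕ → M) :
    ∑ u ∈ words 1, F (height 1 u) = F 1 := by
  rw [sum_words_succ, words, Finset.sum_singleton, sum_extensions_height]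
  simp [height, stack]

/-! ### Closed forms -/

lemma extensionCount_succ_succ (t h : ℕ) :
    extensionCount (t + 1) (h + 1) = extensionCount (t + 1) h + extensionCount t (h + 2) := by
  rw [extensionCount, Finset.sum_range_succ, ← extensionCount.eq_2]

/-- The count is a ballot number, a difference of adjacent binomials, written additively to avoid
truncated subtraction. It follows from Pascal's rule by induction on `t`, then `h`. -/
lemma extensionCount_add_choose (t h : ℕ) :
    extensionCount (t + 1) h + (2 * t + h + 2).choose t = (2 * t + h + 2).choose (t + 1) := by
  induction t generalizing h with
  | zero => simp [extensionCount]
  | succ t iht =>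
    induction h with
    | zero =>
      have h1 := iht 1
      have h0 : extensionCount (t + 1 + 1) 0 = extensionCount (t + 1) 1 := by
        rw [extensionCount]; simp
      -- At the boundary height `0`, the symmetry of the middle binomials supplies the missing term.
      have hs : (2 * t + 3).choose (t + 1) = (2 * t + 3).choose (t + 2) :=
        Nat.choose_symm_of_eq_add (by omega)
      have e1 := Nat.choose_succ_succ (2 * t + 3) t
      have e2 := Nat.choose_succ_succ (2 * t + 3) (t + 1)
      rw [h0]
      rw [show 2 * t + 1 + 2 = 2 * t + 3 by omega] at h1
      rw [show 2 * (t + 1) + 0 + 2 = 2 * t + 3 + 1 by omega]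
      simp only [Nat.succ_eq_add_one, add_assoc, Nat.reduceAdd] at *
      omega
    | succ h ihh =>
      have h1 := iht (h + 2)
      have e1 := Nat.choose_succ_succ (2 * t + h + 4) t
      have e2 := Nat.choose_succ_succ (2 * t + h + 4) (t + 1)
      rw [extensionCount_succ_succ]
      rw [show 2 * t + (h + 2) + 2 = 2 * t + h + 4 by omega] at h1
      rw [show 2 * (t + 1) + h + 2 = 2 * t + h + 4 by omega] at ihh
      rw [show 2 * (t + 1) + (h + 1) + 2 = 2 * t + h + 4 + 1 by omega]
      simp only [Nat.succ_eq_add_one, add_assoc, Nat.reduceAdd] at *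
      omega

lemma ascentCount_succ_zero (c R : ℕ) :
    ascentCount c (R + 1) 0 = extensionCount (R + 1) c + ascentCount c R 1 := by
  simp [ascentCount]

lemma ascentCount_succ_succ (c R j : ℕ) :
    ascentCount c (R + 1) (j + 1) =
      ascentCount c (R + 1) j + extensionCount R (j + c + 2) + ascentCount c R (j + 2) := by
  rw [ascentCount, ascentCount, Finset.sum_range_succ, show j + 1 + c = j + c + 1 by omega,
    extensionCount_succ_succ]
  ring

/-- Only `j = 1` is needed later, but the recursion passes through all heights. Differencing in `j`
reduces it to Pascal's rule and the ballot formula. -/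
lemma ascentCount_succ (c R j : ℕ) :
    ascentCount c (R + 1) j =
      j * (2 * R + j + c + 2).choose R + (2 * R + j + c + 2).choose (R + 1) := by
  induction R generalizing j with
  | zero =>
    induction j with
    | zero => simp [ascentCount, extensionCount]
    | succ j ih =>
      rw [ascentCount_succ_succ, ih]
      simp [ascentCount, extensionCount]
      ring
  | succ R ihR =>
    induction j with
    | zero =>
      have h1 := extensionCount_add_choose (R + 1) c
      have e1 := Nat.choose_succ_succ (2 * R + c + 3) R
      rw [ascentCount_succ_zero, ihR]
      rw [show 2 * (R + 1) + c + 2 = 2 * R + c + 3 + 1 by omega] at h1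
      rw [show 2 * R + 1 + c + 2 = 2 * R + c + 3 by omega,
        show 2 * (R + 1) + 0 + c + 2 = 2 * R + c + 3 + 1 by omega]
      simp only [Nat.succ_eq_add_one] at e1
      omega
    | succ j ihj =>
      have h1 := extensionCount_add_choose R (j + c + 2)
      have e1 := Nat.choose_succ_succ (2 * R + j + c + 4) R
      have e2 := Nat.choose_succ_succ (2 * R + j + c + 4) (R + 1)
      rw [ascentCount_succ_succ, ihR, ihj]
      rw [show 2 * R + (j + c + 2) + 2 = 2 * R + j + c + 4 by omega] at h1
      rw [show 2 * (R + 1) + j + c + 2 = 2 * R + j + c + 4 by omega,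
        show 2 * R + (j + 2) + c + 2 = 2 * R + j + c + 4 by omega,
        show 2 * (R + 1) + (j + 1) + c + 2 = 2 * R + j + c + 4 + 1 by omega]
      simp only [Nat.succ_eq_add_one] at e1 e2
      rw [e1, e2]
      linarith

lemma ascentCount_one (c R : ℕ) : ascentCount c R 1 = (2 * R + c + 2).choose R := by
  cases R with
  | zero => simp [ascentCount]
  | succ R =>
    rw [ascentCount_succ, one_mul, show 2 * (R + 1) + c + 2 = 2 * R + 1 + c + 2 + 1 by omega,
      Nat.choose_succ_succ (2 * R + 1 + c + 2)]

/-! ### Partitions and their canonical words -/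

lemma min_injOn_parts {n : ℕ} (P : Finpartition (Finset.univ : Finset (Fin n))) :
    Set.InjOn Finset.min (P.parts : Set (Finset (Fin n))) := by
  intro B hB C hC h
  obtain ⟨b, hb⟩ := Finset.min_of_nonempty (P.nonempty_of_mem_parts hB)
  exact P.eq_of_mem_parts hB hC (Finset.mem_of_min hb) (Finset.mem_of_min (h ▸ hb))

lemma part_mem_parts {n : ℕ} (P : Finpartition (Finset.univ : Finset (Fin n))) (i : Fin n) :
    P.part i ∈ P.parts := P.part_mem.2 (Finset.mem_univ i)

lemma letter_pos {n : ℕ} (P : Finpartition (Finset.univ : Finset (Fin n))) (i : Fin n) :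
    1 ≤ letter P i :=
  Finset.card_pos.2 ⟨P.part i, Finset.mem_filter.2 ⟨part_mem_parts P i, le_rfl⟩⟩

lemma letter_eq_iff {n : ℕ} (P : Finpartition (Finset.univ : Finset (Fin n))) (i j : Fin n) :
    letter P i = letter P j ↔ P.part i = P.part j := by
  constructor
  · intro h
    wlog hij : (P.part i).min ≤ (P.part j).min generalizing i j
    · exact (this j i h.symm (le_of_not_ge hij)).symm
    have hsub : P.parts.filter (fun B => B.min ≤ (P.part i).min) ⊆
        P.parts.filter (fun B => B.min ≤ (P.part j).min) :=
      Finset.monotone_filter_right _ fun B _ hB => hB.trans hij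
    have heq := Finset.eq_of_subset_of_card_le hsub h.ge
    have hj : P.part j ∈ P.parts.filter (fun B => B.min ≤ (P.part j).min) :=
      Finset.mem_filter.2 ⟨part_mem_parts P j, le_rfl⟩
    rw [← heq] at hj
    exact min_injOn_parts P (part_mem_parts P i) (part_mem_parts P j)
      (le_antisymm hij (Finset.mem_filter.1 hj).2)
  · intro h
    rw [letter, letter, h]

/-- The witness is the minimum of the block preceding that of `i` in the order of minima. -/
lemma exists_letter_eq_pred {n : ℕ} (P : Finpartition (Finset.univ : Finset (Fin n))) (i : Fin n)
    (h : 2 ≤ letter P i) : ∃ j < i, letter P j + 1 = letter P i := by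
  set S := P.parts.filter (fun B => B.min ≤ (P.part i).min) with hS
  have hi : P.part i ∈ S := Finset.mem_filter.2 ⟨part_mem_parts P i, le_rfl⟩
  have hcard : (S.erase (P.part i)).card + 1 = letter P i := Finset.card_erase_add_one hi
  obtain ⟨B, hB, hmax⟩ := Finset.exists_max_image (S.erase (P.part i)) Finset.min
    (Finset.card_pos.1 (by omega))
  obtain ⟨hne, hBS⟩ := Finset.mem_erase.1 hB
  obtain ⟨hBP, hBi⟩ := Finset.mem_filter.1 hBS
  have hlt : B.min < (P.part i).min :=
    lt_of_le_of_ne hBi fun h => hne (min_injOn_parts P hBP (part_mem_parts P i) h)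
  obtain ⟨j, hj⟩ := Finset.min_of_nonempty (P.nonempty_of_mem_parts hBP)
  have hjB : P.part j = B := P.part_eq_of_mem hBP (Finset.mem_of_min hj)
  refine ⟨j, ?_, ?_⟩
  · have := hlt.trans_le (Finset.min_le (P.mem_part (Finset.mem_univ i)))
    rw [hj] at this
    exact WithTop.coe_lt_coe.1 this
  · rw [← hcard, letter, hjB]
    congr 2
    ext C
    rw [Finset.mem_filter, Finset.mem_erase, hS, Finset.mem_filter]
    constructor
    · rintro ⟨hC, hCB⟩
      refine ⟨?_, hC, hCB.trans hBi⟩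
      rintro rfl
      exact hCB.not_gt hlt
    · rintro ⟨hCi, hC, hCm⟩
      exact ⟨hC, hmax C (Finset.mem_erase.2 ⟨hCi, Finset.mem_filter.2 ⟨hC, hCm⟩⟩)⟩

lemma exists_letter_eq {n : ℕ} (P : Finpartition (Finset.univ : Finset (Fin n))) (i : Fin n)
    {v : ℕ} (hv : 1 ≤ v) (hvi : v < letter P i) : ∃ j < i, letter P j = v := by
  induction hd : letter P i - v generalizing i with
  | zero => omega
  | succ d ih =>
    obtain ⟨j, hj, hji⟩ := exists_letter_eq_pred P i (by omega)
    by_cases hjv : letter P j = v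
    · exact ⟨j, hj, hjv⟩
    · obtain ⟨k, hk, hkv⟩ := ih j (by omega) (by omega)
      exact ⟨k, hk.trans hj, hkv⟩

/-- The canonical sequential form, extended by zero. -/
def extendedForm {n : ℕ} (P : Finpartition (Finset.univ : Finset (Fin n))) (i : ℕ) : ℕ :=
  if h : i < n then letter P ⟨i, h⟩ else 0

lemma extendedForm_of_lt {n : ℕ} (P : Finpartition (Finset.univ : Finset (Fin n))) {i : ℕ}
    (h : i < n) : extendedForm P i = letter P ⟨i, h⟩ := dif_pos h

lemma extendedForm_attains {n : ℕ} (P : Finpartition (Finset.univ : Finset (Fin n))) {i v : ℕ}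
    (hi : i < n) (hv : 1 ≤ v) (hvi : v < extendedForm P i) : ∃ j < i, extendedForm P j = v := by
  rw [extendedForm_of_lt P hi] at hvi
  obtain ⟨j, hj, hjv⟩ := exists_letter_eq P _ hv hvi
  exact ⟨j, hj, by rw [extendedForm_of_lt P j.2, hjv]⟩

lemma isNCWord_extendedForm {n : ℕ} {P : Finpartition (Finset.univ : Finset (Fin n))} :
    IsNCWord n (extendedForm P) ↔ IsNonCrossing P := by
  constructor
  · rintro h ⟨i, j, k, l, hij, hjk, hkl, hik, hjl, hlt⟩
    refine h.nonCrossing i j k l hij hjk hkl l.2 ?_ ?_ ?_ <;> simpa [extendedForm]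
  · intro h
    refine ⟨fun i hi => ?_, fun i hi v hv hvi => extendedForm_attains P hi hv hvi,
      fun i j k l hij hjk hkl hl hik hjl hlt => h ?_, fun i hi => dif_neg (by omega)⟩
    · rw [extendedForm_of_lt P hi]
      exact letter_pos P _
    · rw [extendedForm_of_lt P (by omega), extendedForm_of_lt P (by omega)] at hik hjl hlt
      exact ⟨_, _, _, _, hij, hjk, hkl, hik, hjl, hlt⟩

lemma extendedForm_injective {n : ℕ} :
    Function.Injective (extendedForm : Finpartition (Finset.univ : Finset (Fin n)) → ℕ → ℕ) := by
  intro P Q h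
  have hpart : ∀ i, P.part i = Q.part i := by
    intro i
    ext j
    have h1 : ∀ R : Finpartition (Finset.univ : Finset (Fin n)),
        j ∈ R.part i ↔ letter R j = letter R i := fun R => by
      rw [letter_eq_iff, R.mem_part_iff_part_eq_part (Finset.mem_univ _) (Finset.mem_univ _)]
    have h2 : ∀ k, letter P k = letter Q k := fun k => by
      rw [← extendedForm_of_lt P k.2, ← extendedForm_of_lt Q k.2, h]
    rw [h1, h1, h2, h2]
  have hle : ∀ P Q : Finpartition (Finset.univ : Finset (Fin n)),
      (∀ i, P.part i = Q.part i) → P.parts ⊆ Q.parts := by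
    intro P Q h B hB
    obtain ⟨i, hi⟩ := P.nonempty_of_mem_parts hB
    rw [← P.part_eq_of_mem hB hi, h]
    exact part_mem_parts Q i
  exact Finpartition.ext (le_antisymm (hle P Q hpart) (hle Q P fun i => (hpart i).symm))

/-- At a first disagreement the smaller value would already have occurred in both words,
contradicting the equal kernels. -/
lemma eq_of_same_kernel {n : ℕ} {u w : ℕ → ℕ}
    (hu : ∀ i < n, 1 ≤ u i) (hw : ∀ i < n, 1 ≤ w i)
    (hu' : ∀ i < n, ∀ v, 1 ≤ v → v < u i → ∃ j < i, u j = v)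
    (hw' : ∀ i < n, ∀ v, 1 ≤ v → v < w i → ∃ j < i, w j = v)
    (h : ∀ i < n, ∀ j < n, u i = u j ↔ w i = w j) : ∀ i < n, u i = w i := by
  intro i
  induction i using Nat.strong_induction_on with
  | _ i ih =>
    intro hi
    rcases lt_trichotomy (u i) (w i) with hlt | heq | hlt
    · obtain ⟨j, hj, hji⟩ := hw' i hi _ (hu i hi) hlt
      rw [← ih j hj (by omega)] at hji
      have := (h j (by omega) i hi).1 hji
      have := ih j hj (by omega)
      omega
    · exact heq
    · obtain ⟨j, hj, hji⟩ := hu' i hi _ (hw i hi) hlt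
      rw [ih j hj (by omega)] at hji
      have := (h j (by omega) i hi).2 hji
      have := ih j hj (by omega)
      omega

lemma IsNCWord.exists_extendedForm_eq {n : ℕ} {w : ℕ → ℕ} (h : IsNCWord n w) :
    ∃ P : Finpartition (Finset.univ : Finset (Fin n)), extendedForm P = w := by
  classical
  let s : Setoid (Fin n) := Setoid.ker fun i : Fin n => w i
  let P : Finpartition (Finset.univ : Finset (Fin n)) := Finpartition.ofSetoid s
  have hker : ∀ i j : Fin n, letter P i = letter P j ↔ w i = w j := by
    intro i j
    rw [letter_eq_iff, ← P.mem_part_iff_part_eq_part (Finset.mem_univ _) (Finset.mem_univ _),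
      Finpartition.mem_part_ofSetoid_iff_rel]
    exact ⟨fun h => h.symm, fun h => h.symm⟩
  refine ⟨P, funext fun i => ?_⟩
  by_cases hi : i < n
  · refine eq_of_same_kernel (fun i hi => ?_) h.pos
      (fun i hi v hv hvi => extendedForm_attains P hi hv hvi) h.attains (fun i hi j hj => ?_) i hi
    · rw [extendedForm_of_lt P hi]
      exact letter_pos P _
    · rw [extendedForm_of_lt P hi, extendedForm_of_lt P hj]
      exact hker ⟨i, hi⟩ ⟨j, hj⟩
  · rw [h.support i (by omega)]
    exact dif_neg hi

lemma sum_NC {M : Type*} [AddCommMonoid M] (n : ℕ) (F : (ℕ → ℕ) → M) :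
    ∑ P ∈ NC n, F (extendedForm P) = ∑ w ∈ words n, F w := by
  refine Finset.sum_bij (fun P _ => extendedForm P) (fun P hP => ?_)
    (fun P _ Q _ h => extendedForm_injective h) (fun w hw => ?_) fun _ _ => rfl
  · exact mem_words.2 (isNCWord_extendedForm.2 (Finset.mem_filter.1 hP).2)
  · obtain ⟨P, rfl⟩ := (mem_words.1 hw).exists_extendedForm_eq
    exact ⟨P, Finset.mem_filter.2 ⟨Finset.mem_univ P, isNCWord_extendedForm.1 (mem_words.1 hw)⟩,
      rfl⟩

/-! ### Occurrences as ascents followed by a plateau -/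

lemma length_pattern (a c : ℕ) : (pattern a (c + 1)).length = c + a := by
  simp [pattern]

lemma getD_pattern {a c p : ℕ} (hp : p < c + a) :
    (pattern a (c + 1)).getD p 0 = min p c + 1 := by
  rw [pattern, Nat.add_sub_cancel]
  by_cases h : p < c
  · rw [List.getD_append _ _ _ _ (by simpa using h), List.getD_eq_getElem _ _ (by simpa using h),
      List.getElem_range']
    omega
  · rw [List.getD_append_right _ _ _ _ (by simpa using h),
      List.getD_eq_getElem _ _ (by simp; omega), List.getElem_replicate]
    omega

lemma length_canonicalForm {n : ℕ} (P : Finpartition (Finset.univ : Finset (Fin n))) :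
    (canonicalForm P).length = n := by
  simp [canonicalForm]

lemma getD_canonicalForm {n : ℕ} (P : Finpartition (Finset.univ : Finset (Fin n))) {i L p : ℕ}
    (hp : p < L) (hL : i + L ≤ n) :
    (((canonicalForm P).drop i).take L).getD p 0 = extendedForm P (i + p) := by
  rw [List.getD_eq_getElem _ _ (by simp [canonicalForm]; omega),
    extendedForm_of_lt P (show i + p < n by omega)]
  simp [canonicalForm]

lemma Ascends.lt {i c : ℕ} {w : ℕ → ℕ} (h : Ascends i c w) {p q : ℕ} (hpq : p < q) (hq : q ≤ c) :
    w (i + p) < w (i + q) := by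
  induction q, hpq using Nat.le_induction with
  | base => exact h p (by omega)
  | succ q hpq ih => exact (ih (by omega)).trans (h q (by omega))

lemma Plateau.eq {i d : ℕ} {w : ℕ → ℕ} (h : Plateau i d w) {p : ℕ} (hp : p ≤ d) :
    w (i + p) = w i := by
  induction p with
  | zero => rfl
  | succ p ih => exact (h p (by omega)).symm.trans (ih (by omega))

lemma ascends_and_plateau_iff {i c d : ℕ} {w : ℕ → ℕ} :
    (Ascends i c w ∧ Plateau (i + c) d w) ↔
      ∀ p < c + (d + 1), ∀ q < c + (d + 1), w (i + p) < w (i + q) ↔ min p c + 1 < min q c + 1 := by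
  constructor
  · rintro ⟨hA, hP⟩
    have hmin : ∀ p < c + (d + 1), w (i + p) = w (i + min p c) := by
      intro p hp
      rcases le_total p c with h | h
      · rw [min_eq_left h]
      · rw [min_eq_right h, ← hP.eq (p := p - c) (by omega)]
        congr 1
        omega
    intro p hp q hq
    rw [hmin p hp, hmin q hq, Nat.add_lt_add_iff_right]
    constructor
    · intro h
      by_contra hle
      rcases (not_lt.1 hle).eq_or_lt with h1 | h1
      · rw [h1] at h
        exact h.false
      · exact h.asymm (hA.lt h1 (min_le_right _ _))
    · exact fun h => hA.lt h (min_le_right _ _)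
  · intro h
    refine ⟨fun p hp => ?_, fun p hp => ?_⟩
    · exact (h p (by omega) (p + 1) (by omega)).2 (by omega)
    -- Strict comparison fails in both directions, which forces equality.
    · have h1 := h (c + p) (by omega) (c + p + 1) (by omega)
      have h2 := h (c + p + 1) (by omega) (c + p) (by omega)
      rw [show i + (c + p + 1) = i + c + p + 1 by omega, ← add_assoc] at h1 h2
      omega

lemma orderIsomorphic_pattern_iff {n : ℕ} (P : Finpartition (Finset.univ : Finset (Fin n)))
    {i c d : ℕ} (h : i + (c + (d + 1)) ≤ n) :
    OrderIsomorphic (((canonicalForm P).drop i).take (c + (d + 1))) (pattern (d + 1) (c + 1)) ↔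
      Ascends i c (extendedForm P) ∧ Plateau (i + c) d (extendedForm P) := by
  have hlen : (((canonicalForm P).drop i).take (c + (d + 1))).length = c + (d + 1) := by
    rw [List.length_take, List.length_drop, length_canonicalForm]
    omega
  rw [OrderIsomorphic, hlen, length_pattern, ascends_and_plateau_iff, and_iff_right rfl]
  refine forall₂_congr fun p hp => forall₂_congr fun q hq => ?_
  rw [getD_canonicalForm P hp h, getD_canonicalForm P hq h, getD_pattern hp, getD_pattern hq]

open Classical in
lemma occurrences_pattern {c d R : ℕ}
    (P : Finpartition (Finset.univ : Finset (Fin (c + (d + 1) + R)))) :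
    occurrences (pattern (d + 1) (c + 1)) (canonicalForm P) =
      ∑ i ∈ Finset.range (R + 1),
        if Ascends i c (extendedForm P) ∧ Plateau (i + c) d (extendedForm P) then 1 else 0 := by
  rw [occurrences, ← Finset.card_filter]
  congr 1
  ext i
  rw [Finset.mem_filter, Finset.mem_filter, length_pattern, length_canonicalForm,
    Finset.mem_range, Finset.mem_range]
  constructor
  · rintro ⟨-, h, ho⟩
    exact ⟨by omega, (orderIsomorphic_pattern_iff P h).1 ho⟩
  · rintro ⟨hi, h⟩
    exact ⟨by omega, by omega, (orderIsomorphic_pattern_iff P (by omega)).2 h⟩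

theorem sum_occurrences_pattern (c d R : ℕ) :
    ∑ P ∈ NC (c + (d + 1) + R), occurrences (pattern (d + 1) (c + 1)) (canonicalForm P) =
      (2 * R + c + 2).choose R := by
  classical
  simp only [occurrences_pattern]
  rw [sum_NC _ fun w => ∑ i ∈ Finset.range (R + 1),
    if Ascends i c w ∧ Plateau (i + c) d w then 1 else 0, Finset.sum_comm, ← ascentCount_one,
    ← sum_words_one fun h => ascentCount c R h, sum_words_ascentCount]
  refine Finset.sum_congr rfl fun i hi => ?_
  rw [Finset.mem_range] at hi
  rw [← Finset.card_filter, add_comm 1 i, ← card_words_ascends_plateau i c d (R - i),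
    show i + c + d + 1 + (R - i) = c + (d + 1) + R by omega]

end NCSubword

theorem corollary3p1 (n a m r : ℕ) (ha : 2 ≤ a) (hm : 2 ≤ m) (hn : a + m - 1 ≤ n)
    (hr : (r : ℤ) = (n : ℤ) - a - m + 2) :
    ((∑ P ∈ NCSubword.NC n,
        NCSubword.occurrences (NCSubword.pattern a m) (NCSubword.canonicalForm P) : ℕ) : ℚ) =
      (r : ℚ) / (2 * r + m) * ((2 * r + m).choose r : ℚ) := by
  obtain ⟨d, rfl⟩ : ∃ d, a = d + 1 := ⟨a - 1, by omega⟩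
  obtain ⟨c, rfl⟩ : ∃ c, m = c + 1 := ⟨m - 1, by omega⟩
  -- `R` is `n` minus the pattern length, so occurrences start at `0, …, R`.
  obtain ⟨R, rfl⟩ : ∃ R, r = R + 1 := ⟨r - 1, by omega⟩
  obtain rfl : n = c + (d + 1) + R := by omega
  rw [NCSubword.sum_occurrences_pattern]
  -- The absorption identity turns the binomial into the quotient form.
  have h := Nat.add_one_mul_choose_eq (2 * R + c + 2) R
  rw [show 2 * (R + 1) + (c + 1) = 2 * R + c + 2 + 1 by omega]
  have h' : ((2 * R + c + 2 + 1 : ℕ) : ℚ) * ((2 * R + c + 2).choose R : ℚ) =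
      ((2 * R + c + 2 + 1).choose (R + 1) : ℚ) * ((R + 1 : ℕ) : ℚ) := by exact_mod_cast h
  have hne : (2 * ((R + 1 : ℕ) : ℚ) + ((c + 1 : ℕ) : ℚ)) ≠ 0 := by positivity
  rw [div_mul_eq_mul_div, eq_div_iff hne, mul_comm ((R + 1 : ℕ) : ℚ), ← h']
  push_cast
  ring
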